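/- Let $k(n)$ denote the kissing number in dimension $n$, i.e. the maximum number of pairwise non-overlapping unit balls in $\mathbb R^n$ that touch, without overlapping it, a central unit ball. Then $$k(10)\le 594 .$$ Moreover, for $k\ge 0$ let $G_k^{(10)}$ be the Gegenbauer polynomials for dimension $10$: $G_k^{(10)}$ has degree $k$, $G_k^{(10)}(1)=1$, and they are orthogonal on $[-1,1]$ with respect to the weight $(1-t^2)^{7/2}$; equivalently $G_0^{(10)}=1$, $G_1^{(10)}=t$ and $(k+7)\,G_k^{(10)}=(2k+6)\,t\,G_{k-1}^{(10)}-(k-1)\,G_{k-2}^{(10)}$ for $k\ge 2$. Let $$f_{\pi/3}(t)=\begin{cases}1-2t^2,& t<-\tfrac1{\sqrt2},\\ 0,& -\tfrac1{\sqrt2}\le t\le \tfrac12,\\ 2t-1,& t>\tfrac12,\end{cases}$$ and $$\begin{aligned}f={}&0.013483\,G_1^{(10)}+0.0519007\,G_2^{(10)}+0.1256323\,G_3^{(10)}+0.2121789\,G_4^{(10)}+0.2486231\,G_5^{(10)}\\&+0.2032308\,G_6^{(10)}+0.09343\,G_7^{(10)}+0.04367\,G_{11}^{(10)}+0.006165\,f_{\pi/3}.\end{aligned}$$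 Then, with $c=\frac1{594.9}$: 1. $\sum_{i,j=1}^N f(\langle x_i,x_j\rangle)\ge 0$ for every $N$ and all unit vectors $x_1,\dots,x_N\in\mathbb R^{10}$ whose pairwise angular distances are at least $\pi/3$; 2. $f(t)+c<0$ for $-1\le t\le \frac12=\cos\frac{\pi}{3}$; 3. $f(1)+c<1$. -/

import Mathlib

/-- `C` is the set of centres of a family of pairwise non-overlapping unit balls in `ℝⁿ`, all of
which touch, and do not overlap, the central unit ball around the origin (two balls overlap when
their interiors meet). -/
structure IsKissingConfiguration (n : ℕ) (C : Set (EuclideanSpace ℝ (Fin n))) : Prop where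
  touches_central : ∀ c ∈ C, (Metric.closedBall c 1 ∩ Metric.closedBall 0 1).Nonempty
  not_overlap_central : ∀ c ∈ C, Disjoint (Metric.ball c 1) (Metric.ball 0 1)
  not_overlap : C.PairwiseDisjoint (fun c => Metric.ball c 1)

/-- The kissing number `k(n)`: the maximal number of non-overlapping unit balls in `ℝⁿ` touching a
central unit ball. It is an element of `ℕ∞`, so that an upper bound by a natural number says
in particular that the numbers of balls are finite and bounded. -/
noncomputable def kissingNumber (n : ℕ) : ℕ∞ :=
  ⨆ (C : Set (EuclideanSpace ℝ (Fin n))) (_ : IsKissingConfiguration n C), C.encard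

/-- `X` is a spherical `(n, N, α)`-code: `N` unit vectors in `ℝⁿ` with pairwise angular distance
at least `α`. -/
structure IsSphericalCode (n N : ℕ) (α : ℝ) (X : Fin N → EuclideanSpace ℝ (Fin n)) : Prop where
  norm_eq_one : ∀ i, ‖X i‖ = 1
  le_angle : ∀ i j, i ≠ j → α ≤ InnerProductGeometry.angle (X i) (X j)

/-- The Gegenbauer (ultraspherical) polynomials `G_k^{(n)}` for `n ≥ 2`, the orthogonal polynomials
of the sphere `S^{n-1}` normalized by `G_k^{(n)}(1) = 1`, given by their three-term recurrence
`(k + n - 3) G_k = (2 k + n - 4) t G_{k-1} - (k - 1) G_{k-2}` with `G_0 = 1` and `G_1 = t`. -/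
noncomputable def gegenbauer (n : ℕ) : ℕ → Polynomial ℝ
  | 0 => 1
  | 1 => Polynomial.X
  | k + 2 =>
      Polynomial.C (((k : ℝ) + n - 1)⁻¹) *
        (Polynomial.C (2 * (k : ℝ) + n) * Polynomial.X * gegenbauer n (k + 1)
          - Polynomial.C ((k : ℝ) + 1) * gegenbauer n k)

/-- The function `f_α`, where `z = cos α`: it is `(z - t²) / (1 - z)` for `t < -√z`, zero for
`-√z ≤ t ≤ z` and `(t - z) / (1 - z)` for `t > z`. -/
noncomputable def fAngle (α t : ℝ) : ℝ :=
  if t < -Real.sqrt (Real.cos α) then (Real.cos α - t ^ 2) / (1 - Real.cos α)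
  else if t ≤ Real.cos α then 0
  else (t - Real.cos α) / (1 - Real.cos α)

/-- The explicit non-negative combination of Gegenbauer polynomials for dimension `10` and of
the function `f_{π/3}`. -/
noncomputable def kissingCertificate (t : ℝ) : ℝ :=
  0.013483 * (gegenbauer 10 1).eval t
    + 0.0519007 * (gegenbauer 10 2).eval t
    + 0.1256323 * (gegenbauer 10 3).eval t
    + 0.2121789 * (gegenbauer 10 4).eval t
    + 0.2486231 * (gegenbauer 10 5).eval t
    + 0.2032308 * (gegenbauer 10 6).eval t
    + 0.09343 * (gegenbauer 10 7).eval t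
    + 0.04367 * (gegenbauer 10 11).eval t
    + 0.006165 * fAngle (Real.pi / 3) t

/-! This is Delsarte's linear programming method, enlarged by a function whose nonnegativity uses
the angle condition. Summed over all ordered pairs of an N-point code, the certificate is
nonnegative; its values are below -c off the diagonal and below 1 - c on it, so the sum is at most N
- cN². Hence N ≤ 1/c = 594.9. Centres of kissing balls, scaled by 1/2, form a π/3-code.

Nonnegativity has two sources. For Gegenbauer polynomials it is Schoenberg's theorem,
`sum_sum_gegenbauer_inner_nonneg`, proved algebraically: homogenizing y ↦ G_k(⟨x, y⟩) gives a
harmonic form `zonal x k`, which in the Fischer inner product represents evaluation at x on harmonic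
forms of degree k, up to a positive constant (`exists_fischer_zonal_eq`). So the values G_k(⟨x_i,
x_j⟩) are, up to that constant, a Gram matrix. For f_{π/3} every row sum is already nonnegative: the
diagonal contributes 1, and `sum_two_mul_inner_sq_sub_one_le_one` shows that the points close to the
antipode subtract at most 1.

Negativity on [-1, 1/2] is a statement about two polynomials of degree 11, whose maxima there are
only about 10⁻⁶ below zero. It is proved on subintervals by exact identities with positive
coefficients in Bernstein form. -/

/-! ### The Fischer inner product and its adjoint differential operators -/

section ZonalHarmonics

open MvPolynomial

variable {σ : Type*} [Fintype σ]

/-- The Fischer inner product on real polynomials, for which multiplication by a variable is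
adjoint to the corresponding partial derivative. -/
noncomputable def fischer : MvPolynomial σ ℝ →ₗ[ℝ] MvPolynomial σ ℝ →ₗ[ℝ] ℝ :=
  (basisMonomials σ ℝ).constr ℝ fun s => ((∏ i, (s i).factorial : ℕ) : ℝ) • lcoeff ℝ s

theorem fischer_monomial (s : σ →₀ ℕ) (a : ℝ) (q : MvPolynomial σ ℝ) :
    fischer (monomial s a) q = a * (((∏ i, (s i).factorial : ℕ) : ℝ) * coeff s q) := by
  have h : monomial s a = a • basisMonomials σ ℝ s := by
    simp [coe_basisMonomials, smul_monomial]
  rw [h, map_smul, fischer, Module.Basis.constr_basis]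
  simp

theorem fischer_self_nonneg (p : MvPolynomial σ ℝ) : 0 ≤ fischer p p := by
  have h : fischer p p
      = ∑ s ∈ p.support, coeff s p * (((∏ i, (s i).factorial : ℕ) : ℝ) * coeff s p) := by
    conv_lhs => enter [1, 2]; rw [p.as_sum]
    rw [map_sum, LinearMap.sum_apply]
    exact Finset.sum_congr rfl fun s _ => fischer_monomial s _ p
  rw [h]
  refine Finset.sum_nonneg fun s _ => ?_
  rw [mul_left_comm]
  exact mul_nonneg (Nat.cast_nonneg _) (mul_self_nonneg _)

/-- The factorial weights are chosen for this: raising the exponent of `X i` multiplies the weight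
by `s i + 1`, the factor that `pderiv i` produces. -/
theorem fischer_X_mul (i : σ) (p q : MvPolynomial σ ℝ) :
    fischer (X i * p) q = fischer p (pderiv i q) := by
  classical
  induction p using MvPolynomial.induction_on' with
  | add p₁ p₂ h₁ h₂ => simp only [mul_add, map_add, LinearMap.add_apply, h₁, h₂]
  | monomial s a =>
    have hX : X i * monomial s a = monomial (s + Finsupp.single i 1) a := by
      rw [X, monomial_mul, one_mul, add_comm]
    have hfac : (∏ j, ((s + Finsupp.single i 1 : σ →₀ ℕ) j).factorial)
        = (s i + 1) * ∏ j, (s j).factorial := by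
      rw [← Finset.mul_prod_erase _ _ (Finset.mem_univ i),
        ← Finset.mul_prod_erase Finset.univ (fun j => (s j).factorial) (Finset.mem_univ i),
        ← mul_assoc]
      congr 1
      · simp [Nat.factorial_succ]
      · refine Finset.prod_congr rfl fun j hj => ?_
        rw [Finsupp.add_apply, Finsupp.single_eq_of_ne (Finset.ne_of_mem_erase hj), add_zero]
    rw [hX, fischer_monomial, fischer_monomial, coeff_pderiv, hfac]
    push_cast
    ring

/-- The linear form `∑ xᵢ Xᵢ`. -/
noncomputable def linForm (x : σ → ℝ) : MvPolynomial σ ℝ := ∑ i, C (x i) * X i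

/-- The squared radius `∑ Xᵢ²`. -/
noncomputable def sqRadius (σ : Type*) [Fintype σ] : MvPolynomial σ ℝ := ∑ i, X i ^ 2

/-- The derivative in the direction `x`. -/
noncomputable def dirDeriv (x : σ → ℝ) : Derivation ℝ (MvPolynomial σ ℝ) (MvPolynomial σ ℝ) :=
  ∑ i, x i • pderiv i

/-- The Laplace operator on polynomials. -/
noncomputable def laplacian : MvPolynomial σ ℝ →ₗ[ℝ] MvPolynomial σ ℝ :=
  ∑ i, (pderiv i).toLinearMap ∘ₗ (pderiv i).toLinearMap

theorem dirDeriv_apply (x : σ → ℝ) (p : MvPolynomial σ ℝ) :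
    dirDeriv x p = ∑ i, C (x i) * pderiv i p := by
  have h : ∀ s : Finset σ, (∑ i ∈ s, x i • pderiv (R := ℝ) i) p = ∑ i ∈ s, C (x i) * pderiv i p := by
    classical
    intro s
    induction s using Finset.induction_on with
    | empty => simp
    | insert a s ha ih => simp [Finset.sum_insert ha, ih, smul_eq_C_mul]
  exact h _

theorem laplacian_apply (p : MvPolynomial σ ℝ) :
    laplacian p = ∑ i, pderiv i (pderiv i p) := by
  simp [laplacian, LinearMap.sum_apply]

theorem pderiv_linForm (x : σ → ℝ) (i : σ) : pderiv i (linForm x) = C (x i) := by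
  classical
  simp [linForm, pderiv_X, Pi.single_apply]

theorem pderiv_sqRadius (i : σ) : pderiv i (sqRadius σ) = 2 * X i := by
  classical
  simp [sqRadius, pderiv_X, Pi.single_apply]

theorem dirDeriv_linForm (x y : σ → ℝ) : dirDeriv x (linForm y) = C (∑ i, x i * y i) := by
  simp [dirDeriv_apply, pderiv_linForm]

theorem dirDeriv_sqRadius (x : σ → ℝ) : dirDeriv x (sqRadius σ) = 2 * linForm x := by
  simp only [dirDeriv_apply, pderiv_sqRadius, linForm, Finset.mul_sum]
  exact Finset.sum_congr rfl fun i _ => by ring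

theorem laplacian_mul (p q : MvPolynomial σ ℝ) :
    laplacian (p * q)
      = p * laplacian q + 2 * ∑ i, pderiv i p * pderiv i q + q * laplacian p := by
  simp only [laplacian_apply, Finset.mul_sum, ← Finset.sum_add_distrib]
  refine Finset.sum_congr rfl fun i _ => ?_
  simp only [pderiv_mul, map_add]
  ring

theorem laplacian_linForm_mul (x : σ → ℝ) (q : MvPolynomial σ ℝ) :
    laplacian (linForm x * q) = linForm x * laplacian q + 2 * dirDeriv x q := by
  rw [laplacian_mul, laplacian_apply (linForm x), dirDeriv_apply]
  simp [pderiv_linForm]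

/-- The cross term of the product rule is 4∑ Xᵢ ∂ᵢq = 4kq by Euler's identity, and the Laplacian of
the squared radius is twice the dimension. -/
theorem laplacian_sqRadius_mul {q : MvPolynomial σ ℝ} {k : ℕ} (hq : q.IsHomogeneous k) :
    laplacian (sqRadius σ * q)
      = sqRadius σ * laplacian q + C (2 * (Fintype.card σ : ℝ) + 4 * k) * q := by
  rw [laplacian_mul, laplacian_apply (sqRadius σ)]
  have h : ∑ i, pderiv i (sqRadius σ) * pderiv i q = 2 * (C (k : ℝ) * q) := by
    have hE := hq.sum_X_mul_pderiv
    simp only [pderiv_sqRadius, mul_assoc, ← Finset.mul_sum, hE, nsmul_eq_mul]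
    simp
  have h2 : ∑ i, pderiv i (pderiv i (sqRadius σ)) = C (2 * (Fintype.card σ : ℝ)) := by
    have : ∀ i : σ, pderiv i (2 * X i : MvPolynomial σ ℝ) = 2 := fun i => by
      rw [two_mul, map_add, pderiv_X_self]; norm_num
    simp only [pderiv_sqRadius, this, Finset.sum_const, Finset.card_univ, nsmul_eq_mul, map_mul,
      map_natCast, map_ofNat]
    ring
  rw [h, h2]
  simp only [map_add, map_mul, map_natCast, map_ofNat]
  ring

theorem fischer_C_mul (a : ℝ) (p q : MvPolynomial σ ℝ) :
    fischer (C a * p) q = a * fischer p q := by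
  rw [← smul_eq_C_mul, map_smul, LinearMap.smul_apply, smul_eq_mul]

theorem fischer_linForm_mul (x : σ → ℝ) (p q : MvPolynomial σ ℝ) :
    fischer (linForm x * p) q = fischer p (dirDeriv x q) := by
  rw [linForm, dirDeriv_apply, Finset.sum_mul, map_sum, map_sum, LinearMap.sum_apply]
  refine Finset.sum_congr rfl fun i _ => ?_
  rw [mul_assoc, fischer_C_mul, fischer_X_mul, ← smul_eq_C_mul, map_smul, smul_eq_mul]

theorem fischer_sqRadius_mul (p q : MvPolynomial σ ℝ) :
    fischer (sqRadius σ * p) q = fischer p (laplacian q) := by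
  rw [sqRadius, laplacian_apply, Finset.sum_mul, map_sum, map_sum, LinearMap.sum_apply]
  refine Finset.sum_congr rfl fun i _ => ?_
  rw [pow_two, mul_assoc, fischer_X_mul, fischer_X_mul]

/-- Mixed partial derivatives commute. Thus directional derivatives of harmonic forms stay harmonic,
as the induction in `exists_fischer_zonal_eq` requires. -/
theorem laplacian_dirDeriv (x : σ → ℝ) (q : MvPolynomial σ ℝ) :
    laplacian (dirDeriv x q) = dirDeriv x (laplacian q) := by
  have hcomm : ∀ (i j : σ) (p : MvPolynomial σ ℝ),
      pderiv i (pderiv j p) = pderiv j (pderiv i p) := by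
    classical
    intro i j p
    ext m
    simp only [coeff_pderiv, Finsupp.add_apply, add_right_comm m (Finsupp.single j 1)]
    rcases eq_or_ne i j with rfl | h
    · ring
    · simp [h, h.symm]
      ring
  simp only [laplacian_apply, dirDeriv_apply, map_sum, pderiv_C_mul]
  rw [Finset.sum_comm]
  refine Finset.sum_congr rfl fun i _ => Finset.sum_congr rfl fun j _ => ?_
  rw [hcomm i j q, hcomm i j]

theorem isHomogeneous_dirDeriv (x : σ → ℝ) {q : MvPolynomial σ ℝ} {k : ℕ}
    (hq : q.IsHomogeneous (k + 1)) : (dirDeriv x q).IsHomogeneous k := by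
  rw [dirDeriv_apply]
  refine IsHomogeneous.sum _ _ _ fun i _ => ?_
  have h := (isHomogeneous_C σ (x i)).mul (hq.pderiv (i := i))
  simpa using h

/-- Direction and point of evaluation coincide, so this is Euler's identity. -/
theorem eval_dirDeriv {x : σ → ℝ} {q : MvPolynomial σ ℝ} {k : ℕ} (hq : q.IsHomogeneous k) :
    eval x (dirDeriv x q) = k * eval x q := by
  have h := congrArg (eval x) hq.sum_X_mul_pderiv
  simpa [dirDeriv_apply] using h

theorem isHomogeneous_linForm (x : σ → ℝ) : (linForm x).IsHomogeneous 1 :=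
  IsHomogeneous.sum _ _ _ fun i _ => by
    simpa using (isHomogeneous_C σ (x i)).mul (isHomogeneous_X ℝ i)

theorem isHomogeneous_sqRadius : (sqRadius σ).IsHomogeneous 2 :=
  IsHomogeneous.sum _ _ _ fun i _ => isHomogeneous_X_pow i 2

/-! ### Zonal harmonics and their reproducing property -/

/-- The solid zonal harmonic of degree `k` with pole `x`, for a unit vector `x`. -/
noncomputable def zonal (x : σ → ℝ) : ℕ → MvPolynomial σ ℝ
  | 0 => 1
  | 1 => linForm x
  | k + 2 =>
      C (((k : ℝ) + Fintype.card σ - 1)⁻¹) *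
        (C (2 * (k : ℝ) + Fintype.card σ) * (linForm x * zonal x (k + 1))
          - C ((k : ℝ) + 1) * (sqRadius σ * zonal x k))

theorem isHomogeneous_zonal (x : σ → ℝ) : ∀ k, (zonal x k).IsHomogeneous k
  | 0 => isHomogeneous_one σ ℝ
  | 1 => isHomogeneous_linForm x
  | k + 2 => by
    have h₁ := (isHomogeneous_linForm x).mul (isHomogeneous_zonal x (k + 1))
    have h₂ := isHomogeneous_sqRadius.mul (isHomogeneous_zonal x k)
    rw [show 1 + (k + 1) = k + 2 by ring] at h₁
    rw [show 2 + k = k + 2 by ring] at h₂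
    rw [zonal]
    simpa using (isHomogeneous_C σ _).mul
      (((isHomogeneous_C σ (2 * (k : ℝ) + Fintype.card σ)).mul h₁).sub
        (by simpa using (isHomogeneous_C σ ((k : ℝ) + 1)).mul h₂))

theorem dirDeriv_C_mul (x : σ → ℝ) (a : ℝ) (p : MvPolynomial σ ℝ) :
    dirDeriv x (C a * p) = C a * dirDeriv x p := by
  rw [C_mul', Derivation.map_smul, C_mul']

theorem laplacian_C_mul (a : ℝ) (p : MvPolynomial σ ℝ) :
    laplacian (C a * p) = C a * laplacian p := by
  rw [← smul_eq_C_mul, map_smul, smul_eq_C_mul]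

/-- This lowering relation is what makes the zonal forms harmonic: in `laplacian_zonal` it makes the
contributions of the two terms of the recurrence cancel. -/
theorem dirDeriv_zonal (hσ : 2 ≤ Fintype.card σ) {x : σ → ℝ} (hx : ∑ i, x i * x i = 1) :
    ∀ k, dirDeriv x (zonal x (k + 1)) = C ((k : ℝ) + 1) * zonal x k
  | 0 => by simp [zonal, dirDeriv_linForm, hx]
  | 1 => by
    have hn : (Fintype.card σ : ℝ) - 1 ≠ 0 := by
      have : (2 : ℝ) ≤ Fintype.card σ := by exact_mod_cast hσ
      linarith
    have hC : C (((Fintype.card σ : ℝ) - 1)⁻¹) * C ((Fintype.card σ : ℝ) - 1)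
        = (1 : MvPolynomial σ ℝ) := by rw [← C_mul, inv_mul_cancel₀ hn, C_1]
    rw [show zonal x (1 + 1) = zonal x (0 + 2) from rfl, zonal.eq_3, dirDeriv_C_mul, map_sub,
      dirDeriv_C_mul, dirDeriv_C_mul]
    simp only [zonal, Derivation.leibniz, smul_eq_mul, dirDeriv_linForm, dirDeriv_sqRadius, hx,
      Derivation.map_one_eq_zero]
    simp only [Nat.cast_zero, Nat.cast_one, zero_add, mul_zero, map_one, mul_one, map_add, map_sub]
      at hC ⊢
    linear_combination (2 * linForm x) * hC
  | k + 2 => by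
    have hn : ((k + 1 : ℕ) : ℝ) + Fintype.card σ - 1 ≠ 0 := by
      have : (2 : ℝ) ≤ Fintype.card σ := by exact_mod_cast hσ
      push_cast
      have := (Nat.cast_nonneg k : (0 : ℝ) ≤ k)
      linarith
    have hn' : (k : ℝ) + Fintype.card σ - 1 ≠ 0 := by
      have : (2 : ℝ) ≤ Fintype.card σ := by exact_mod_cast hσ
      have := (Nat.cast_nonneg k : (0 : ℝ) ≤ k)
      linarith
    have hC : C ((((k + 1 : ℕ) : ℝ) + Fintype.card σ - 1)⁻¹)
        * C (((k + 1 : ℕ) : ℝ) + Fintype.card σ - 1) = (1 : MvPolynomial σ ℝ) := by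
      rw [← C_mul, inv_mul_cancel₀ hn, C_1]
    have hC' : C ((k : ℝ) + Fintype.card σ - 1) * C (((k : ℝ) + Fintype.card σ - 1)⁻¹)
        = (1 : MvPolynomial σ ℝ) := by
      rw [← C_mul, mul_inv_cancel₀ hn', C_1]
    have ih₁ := dirDeriv_zonal hσ hx (k + 1)
    have ih₀ := dirDeriv_zonal hσ hx k
    have hz : C ((k : ℝ) + Fintype.card σ - 1) * zonal x (k + 2)
        = C (2 * (k : ℝ) + Fintype.card σ) * (linForm x * zonal x (k + 1))
          - C ((k : ℝ) + 1) * (sqRadius σ * zonal x k) := by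
      rw [zonal, ← mul_assoc, hC', one_mul]
    rw [zonal, dirDeriv_C_mul, map_sub, dirDeriv_C_mul, dirDeriv_C_mul]
    simp only [Derivation.leibniz, smul_eq_mul, dirDeriv_linForm, dirDeriv_sqRadius, hx, ih₁, ih₀]
    simp only [Nat.cast_add, Nat.cast_one, Nat.cast_ofNat, map_one, mul_one, map_add, map_sub,
      map_mul, map_natCast, map_ofNat] at hC hz ⊢
    generalize C (((k : ℝ) + 1 + Fintype.card σ - 1)⁻¹) = w at hC ⊢
    -- With n the dimension, `hz` turns the terms of lower degree into a multiple of `zonal x (k +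
    -- 2)`, and the coefficients add up by (2k + 2 + n) + (k + 2)(k + n - 1) = (k + 3)(k + n).
    linear_combination (((k : MvPolynomial σ ℝ) + 3) * zonal x (k + 2)) * hC
      - w * ((k : MvPolynomial σ ℝ) + 2) * hz

theorem laplacian_zonal (hσ : 2 ≤ Fintype.card σ) {x : σ → ℝ} (hx : ∑ i, x i * x i = 1) :
    ∀ k, laplacian (zonal x k) = 0
  | 0 => by simp [zonal, laplacian_apply]
  | 1 => by simp [zonal, laplacian_apply, pderiv_linForm]
  | k + 2 => by
    rw [zonal, laplacian_C_mul, map_sub, laplacian_C_mul, laplacian_C_mul, laplacian_linForm_mul,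
      laplacian_sqRadius_mul (isHomogeneous_zonal x k), laplacian_zonal hσ hx k,
      laplacian_zonal hσ hx (k + 1), dirDeriv_zonal hσ hx k]
    simp only [map_add, map_mul, map_natCast, map_ofNat, map_one]
    ring

/-- On the unit sphere the squared radius is 1, and the two recurrences coincide. -/
theorem eval_zonal {n : ℕ} {x y : Fin n → ℝ} (hy : ∑ i, y i * y i = 1) :
    ∀ k, eval y (zonal x k) = (gegenbauer n k).eval (∑ i, x i * y i)
  | 0 => by simp [zonal, gegenbauer]
  | 1 => by simp [zonal, gegenbauer, linForm]
  | k + 2 => by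
    have hr : eval y (sqRadius (Fin n)) = 1 := by simp [sqRadius, pow_two, hy]
    have hl : eval y (linForm x) = ∑ i, x i * y i := by simp [linForm]
    rw [zonal, gegenbauer]
    simp only [map_mul, map_sub, eval_C, hr, hl, eval_zonal hy k, eval_zonal hy (k + 1),
      Polynomial.eval_mul, Polynomial.eval_sub, Polynomial.eval_C, Polynomial.eval_X,
      Fintype.card_fin]
    ring

/-- Pair the recurrence with h: the squared radius moves across as the Laplacian and kills h, while
the linear form becomes a directional derivative, handled by induction and Euler's identity. The
constant must not depend on y, since it is shared by all entries of a Gram matrix. -/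
theorem exists_fischer_zonal_eq (hσ : 2 ≤ Fintype.card σ) (k : ℕ) :
    ∃ b : ℝ, 0 < b ∧ ∀ (y : σ → ℝ) (h : MvPolynomial σ ℝ), h.IsHomogeneous k →
      laplacian h = 0 → fischer (zonal y k) h = b * eval y h := by
  have hn : (2 : ℝ) ≤ Fintype.card σ := by exact_mod_cast hσ
  have h0 : ∀ (y : σ → ℝ) (h : MvPolynomial σ ℝ), h.IsHomogeneous 0 →
      fischer 1 h = eval y h := by
    intro y h hh
    rw [← totalDegree_zero_iff_isHomogeneous, totalDegree_eq_zero_iff_eq_C] at hh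
    rw [hh, show (1 : MvPolynomial σ ℝ) = monomial 0 1 from rfl, fischer_monomial]
    simp
  induction k with
  | zero => exact ⟨1, one_pos, fun y h hh _ => by rw [zonal, h0 y h hh, one_mul]⟩
  | succ k ih =>
    obtain ⟨b, hb, hk⟩ := ih
    have step : ∀ (y : σ → ℝ) (h : MvPolynomial σ ℝ), h.IsHomogeneous (k + 1) →
        laplacian h = 0 →
          fischer (linForm y * zonal y k) h = b * ((k + 1 : ℕ) * eval y h) := by
      intro y h hh hl
      rw [fischer_linForm_mul, hk y _ (isHomogeneous_dirDeriv y hh)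
        (by rw [laplacian_dirDeriv, hl, map_zero]), eval_dirDeriv hh]
    rcases k with _ | k
    · refine ⟨b, hb, fun y h hh hl => ?_⟩
      have := step y h hh hl
      simpa [zonal] using this
    · have hk0 := (Nat.cast_nonneg k : (0 : ℝ) ≤ k)
      refine ⟨((k : ℝ) + Fintype.card σ - 1)⁻¹ * ((2 * (k : ℝ) + Fintype.card σ)
        * (b * (k + 1 + 1 : ℕ))), ?_, fun y h hh hl => ?_⟩
      · have : 0 < (k : ℝ) + Fintype.card σ - 1 := by linarith
        positivity
      · rw [zonal, fischer_C_mul, map_sub, LinearMap.sub_apply, fischer_C_mul, fischer_C_mul,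
          step y h hh hl, fischer_sqRadius_mul, hl, map_zero]
        ring

end ZonalHarmonics

/-! ### Positive definiteness of Gegenbauer polynomials -/

/-- Schoenberg's theorem: the Gegenbauer polynomials `G_k^{(n)}` are positive definite on the unit
sphere of `ℝⁿ`. -/
theorem sum_sum_gegenbauer_inner_nonneg {n : ℕ} (hn : 2 ≤ n) (k : ℕ) {ι : Type*} [Fintype ι]
    (X : ι → EuclideanSpace ℝ (Fin n)) (hX : ∀ i, ‖X i‖ = 1) :
    0 ≤ ∑ i, ∑ j, (gegenbauer n k).eval (inner ℝ (X i) (X j)) := by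
  have hσ : 2 ≤ Fintype.card (Fin n) := by simpa using hn
  have hinner : ∀ i j, inner ℝ (X i) (X j) = ∑ l, X i l * X j l := fun i j => by
    rw [PiLp.inner_apply]
    exact Finset.sum_congr rfl fun l _ => by simp [mul_comm]
  have hone : ∀ i, ∑ l, X i l * X i l = 1 := fun i => by
    rw [← hinner, real_inner_self_eq_norm_sq, hX, one_pow]
  obtain ⟨b, hb, hk⟩ := exists_fischer_zonal_eq hσ k
  have key : ∀ i j, b * (gegenbauer n k).eval (inner ℝ (X i) (X j))
      = fischer (zonal (X j) k) (zonal (X i) k) := fun i j => by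
    rw [hk (X j) _ (isHomogeneous_zonal (X i) k) (laplacian_zonal hσ (hone i) k),
      eval_zonal (hone j), hinner]
  -- The Fischer square of the sum of all zonal forms expands to b times the double sum.
  have h := fischer_self_nonneg (∑ i, zonal (X i : Fin n → ℝ) k)
  simp only [map_sum, LinearMap.sum_apply, ← key, ← Finset.mul_sum] at h
  exact nonneg_of_mul_nonneg_right h hb

/-! ### Nonnegativity of f_{π/3} on codes -/

/-- If points `v j` on the unit sphere have pairwise inner products at most `1/2` and
inner products `c j ≥ 1/√2` with a further unit vector `y`, then `∑ (2 c_j² - 1) ≤ 1`. -/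
theorem sum_two_mul_inner_sq_sub_one_le_one {E ι : Type*} [NormedAddCommGroup E]
    [InnerProductSpace ℝ E] (s : Finset ι) (y : E) (v : ι → E) (hy : ‖y‖ = 1)
    (hv : ∀ j ∈ s, ‖v j‖ = 1)
    (hvv : ∀ j ∈ s, ∀ k ∈ s, j ≠ k → inner ℝ (v j) (v k) ≤ 1 / 2)
    (hc : ∀ j ∈ s, 0 ≤ inner ℝ y (v j) ∧ 1 / 2 ≤ inner ℝ y (v j) ^ 2) :
    ∑ j ∈ s, (2 * inner ℝ y (v j) ^ 2 - 1) ≤ 1 := by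
  classical
  set c : ι → ℝ := fun j => inner ℝ y (v j) with hcdef
  set m : ℝ := (s.card : ℝ) with hm
  set S : ℝ := ∑ j ∈ s, c j with hS
  set Q : ℝ := ∑ j ∈ s, c j ^ 2 with hQ
  have hm0 : 0 ≤ m := Nat.cast_nonneg _
  -- Cauchy–Schwarz for y and w = ∑ μⱼvⱼ. The Gram matrix of the vⱼ is entrywise at most (I + J)/2,
  -- with J the all-ones matrix; nonnegative weights carry this over to the quadratic form.
  have quad : ∀ μ : ι → ℝ, (∀ j ∈ s, 0 ≤ μ j) →
      2 * (∑ j ∈ s, μ j * c j) ^ 2 ≤ ∑ j ∈ s, μ j ^ 2 + (∑ j ∈ s, μ j) ^ 2 := by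
    intro μ hμ
    set w : E := ∑ j ∈ s, μ j • v j with hw
    have hyw : inner ℝ y w = ∑ j ∈ s, μ j * c j := by
      simp [hw, inner_sum, inner_smul_right, hcdef]
    have hww : inner ℝ w w ≤ (∑ j ∈ s, μ j ^ 2) / 2 + (∑ j ∈ s, μ j) ^ 2 / 2 := by
      have h1 : inner ℝ w w = ∑ j ∈ s, ∑ k ∈ s, μ j * μ k * inner ℝ (v j) (v k) := by
        simp only [hw, sum_inner, inner_sum, inner_smul_left, inner_smul_right, Finset.mul_sum]
        exact Finset.sum_congr rfl fun j _ => Finset.sum_congr rfl fun k _ => by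
          simp only [conj_trivial]; rw [real_inner_comm]; ring
      have h2 : (∑ j ∈ s, μ j ^ 2) / 2 + (∑ j ∈ s, μ j) ^ 2 / 2
          = ∑ j ∈ s, ∑ k ∈ s, μ j * μ k * ((if j = k then 1 / 2 else 0) + 1 / 2) := by
        have h3 : ∀ j ∈ s, ∑ k ∈ s, μ j * μ k * ((if j = k then 1 / 2 else 0) + 1 / 2)
            = μ j ^ 2 / 2 + μ j * (∑ k ∈ s, μ k) / 2 := by
          intro j hj
          simp only [mul_add, Finset.sum_add_distrib, mul_ite, mul_zero, Finset.sum_ite_eq,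
            if_pos hj, ← Finset.sum_mul, ← Finset.mul_sum]
          ring
        rw [Finset.sum_congr rfl h3, Finset.sum_add_distrib, ← Finset.sum_div, ← Finset.sum_div,
          ← Finset.sum_mul, sq (∑ j ∈ s, μ j)]
      rw [h1, h2]
      refine Finset.sum_le_sum fun j hj => Finset.sum_le_sum fun k hk => ?_
      refine mul_le_mul_of_nonneg_left ?_ (mul_nonneg (hμ j hj) (hμ k hk))
      split_ifs with h
      · subst h; rw [real_inner_self_eq_norm_sq, hv j hj]; norm_num
      · simpa using hvv j hj k hk h
    have hcs : inner ℝ y w ^ 2 ≤ inner ℝ w w := by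
      have := abs_real_inner_le_norm y w
      rw [hy, one_mul] at this
      rw [real_inner_self_eq_norm_sq, ← sq_abs]
      exact pow_le_pow_left₀ (abs_nonneg _) this 2
    rw [hyw] at hcs
    linarith
  have hS2 : 2 * S ^ 2 ≤ m + m ^ 2 := by
    simpa [hS, hm] using quad (fun _ => 1) fun _ _ => zero_le_one
  have hS0 : 0 ≤ S := Finset.sum_nonneg fun j hj => (hc j hj).1
  -- These weights are (I + J)⁻¹c, the optimal choice in `quad`. They are nonnegative because `hS2`
  -- gives (S/(m+1))² ≤ 1/2 ≤ cⱼ².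
  have hμ : ∀ j ∈ s, 0 ≤ c j - S / (m + 1) := by
    intro j hj
    obtain ⟨h0, h1⟩ := hc j hj
    have h2 : (S / (m + 1)) ^ 2 ≤ c j ^ 2 := by
      refine le_trans ?_ h1
      rw [div_pow, div_le_iff₀ (by positivity)]
      nlinarith
    have := abs_le_of_sq_le_sq h2 h0
    linarith [(abs_le.1 this).2]
  have h := quad _ hμ
  have e1 : ∑ j ∈ s, (c j - S / (m + 1)) * c j = Q - S ^ 2 / (m + 1) := by
    have : ∀ j ∈ s, (c j - S / (m + 1)) * c j = c j ^ 2 - S / (m + 1) * c j := fun j _ => by ring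
    rw [Finset.sum_congr rfl this, Finset.sum_sub_distrib, ← Finset.mul_sum, ← hS, ← hQ]
    ring
  have e2 : ∑ j ∈ s, (c j - S / (m + 1)) = S / (m + 1) := by
    rw [Finset.sum_sub_distrib, Finset.sum_const, nsmul_eq_mul, ← hS, ← hm]
    field_simp
    ring
  have e3 : ∑ j ∈ s, (c j - S / (m + 1)) ^ 2 = Q - S ^ 2 / (m + 1) - (S / (m + 1)) ^ 2 := by
    have : ∀ j ∈ s, (c j - S / (m + 1)) ^ 2
        = (c j - S / (m + 1)) * c j - (S / (m + 1)) * (c j - S / (m + 1)) := fun j _ => by ring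
    rw [Finset.sum_congr rfl this, Finset.sum_sub_distrib, ← Finset.mul_sum, e1, e2]
    ring
  rw [e1, e2, e3] at h
  -- With A the left side, `h` now reads 2A² ≤ A.
  have h' : Q - S ^ 2 / (m + 1) ≤ 1 / 2 := by nlinarith
  have h'' : S ^ 2 / (m + 1) ≤ m / 2 := by
    rw [div_le_iff₀ (by positivity)]
    nlinarith
  rw [Finset.sum_sub_distrib, ← Finset.mul_sum]
  simp only [Finset.sum_const, nsmul_eq_mul, mul_one]
  change 2 * Q - m ≤ 1
  linarith

theorem fAngle_pi_div_three (t : ℝ) :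
    fAngle (Real.pi / 3) t
      = if t < -√(1 / 2) then 1 - 2 * t ^ 2 else if t ≤ 1 / 2 then 0 else 2 * t - 1 := by
  rw [fAngle, Real.cos_pi_div_three]
  split_ifs <;> ring

theorem IsSphericalCode.inner_le_half {n N : ℕ} {X : Fin N → EuclideanSpace ℝ (Fin n)}
    (hX : IsSphericalCode n N (Real.pi / 3) X) {i j : Fin N} (hij : i ≠ j) :
    inner ℝ (X i) (X j) ≤ 1 / 2 := by
  have h := Real.cos_le_cos_of_nonneg_of_le_pi (by positivity)
    (InnerProductGeometry.angle_le_pi _ _) (hX.le_angle i j hij)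
  rwa [InnerProductGeometry.cos_angle, hX.norm_eq_one, hX.norm_eq_one, mul_one, div_one,
    Real.cos_pi_div_three] at h

/-- Off the diagonal inner products are at most 1/2, so only values below -1/√2 contribute there.
The preceding bound, applied to the antipode `-X i`, limits their total to -1 or more, which the
diagonal value 1 compensates. -/
theorem sum_fAngle_pi_div_three_nonneg {n N : ℕ} {X : Fin N → EuclideanSpace ℝ (Fin n)}
    (hX : IsSphericalCode n N (Real.pi / 3) X) (i : Fin N) :
    0 ≤ ∑ j, fAngle (Real.pi / 3) (inner ℝ (X i) (X j)) := by
  classical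
  have hsq : √(1 / 2 : ℝ) ^ 2 = 1 / 2 := Real.sq_sqrt (by norm_num)
  have hpos := Real.sqrt_nonneg (1 / 2 : ℝ)
  set s : Finset (Fin N) := Finset.univ.filter fun j => inner ℝ (X i) (X j) < -√(1 / 2) with hs
  have hii : inner ℝ (X i) (X i) = (1 : ℝ) := by
    rw [real_inner_self_eq_norm_sq, hX.norm_eq_one, one_pow]
  have h1 := sum_two_mul_inner_sq_sub_one_le_one s (-X i) X (by rw [norm_neg, hX.norm_eq_one])
    (fun j _ => hX.norm_eq_one j) (fun j _ k _ hjk => hX.inner_le_half hjk) (fun j hj => by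
      have h : inner ℝ (X i) (X j) < -√(1 / 2) := (Finset.mem_filter.1 hj).2
      rw [inner_neg_left]
      constructor
      · linarith
      · nlinarith)
  have h2 : ∀ j, fAngle (Real.pi / 3) (inner ℝ (X i) (X j))
      = (if j = i then 1 else 0)
        - if j ∈ s then 2 * inner ℝ (-X i) (X j) ^ 2 - 1 else 0 := by
    intro j
    rw [fAngle_pi_div_three, inner_neg_left]
    by_cases hji : j = i
    · subst hji
      have : j ∉ s := by
        simp only [hs, Finset.mem_filter, hii, not_and, not_lt]
        intro; linarith
      rw [if_neg this, hii, if_neg (by linarith), if_pos rfl]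
      norm_num
    · by_cases hjs : j ∈ s
      · rw [if_pos hjs, if_neg hji, if_pos (Finset.mem_filter.1 hjs).2]
        ring
      · have : ¬ inner ℝ (X i) (X j) < -√(1 / 2) := fun h =>
          hjs (Finset.mem_filter.2 ⟨Finset.mem_univ j, h⟩)
        rw [if_neg hjs, if_neg hji, if_neg this, if_pos (hX.inner_le_half (Ne.symm hji)), sub_zero]
  simp only [h2, Finset.sum_sub_distrib, Finset.sum_ite_eq', Finset.mem_univ, if_true,
    Finset.sum_ite_mem, Finset.univ_inter] at h1 ⊢
  linarith

theorem sum_kissingCertificate_nonneg {N : ℕ} {X : Fin N → EuclideanSpace ℝ (Fin 10)}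
    (hX : IsSphericalCode 10 N (Real.pi / 3) X) :
    0 ≤ ∑ i, ∑ j, kissingCertificate (inner ℝ (X i) (X j)) := by
  have hG := fun k => sum_sum_gegenbauer_inner_nonneg (by norm_num : 2 ≤ 10) k X hX.norm_eq_one
  have hF : 0 ≤ ∑ i, ∑ j, fAngle (Real.pi / 3) (inner ℝ (X i) (X j)) :=
    Finset.sum_nonneg fun i _ => sum_fAngle_pi_div_three_nonneg hX i
  simp only [kissingCertificate, Finset.sum_add_distrib, ← Finset.mul_sum]
  refine add_nonneg ?_ (mul_nonneg (by norm_num) hF)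
  iterate 7 refine add_nonneg ?_ (mul_nonneg (by norm_num) (hG _))
  exact mul_nonneg (by norm_num) (hG 1)

/-! ### Negativity of the certificate polynomials -/

/-- The polynomial that agrees with `kissingCertificate + 1 / 594.9` on `[-1/√2, 1/2]`. -/
noncomputable def certInner (t : ℝ) : ℝ :=
  (-1405559 / 56713800000) + (820543 / 3038750000) * t + (18269773 / 6435000000) * t ^ 2
  + (-437894323 / 27348750000) * t ^ 3 + (-30480107 / 178750000) * t ^ 4
  + (-1929843293 / 6837187500) * t ^ 5 + (7113078 / 11171875) * t ^ 6 + (2748952 / 1519375) * t ^ 7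
  + (-192148 / 95625) * t ^ 9 + (489104 / 478125) * t ^ 11

/-- The polynomial that agrees with `kissingCertificate + 1 / 594.9` on `[-1, -1/√2)`. -/
noncomputable def certOuter (t : ℝ) : ℝ :=
  (174117509 / 28356900000) + (820543 / 3038750000) * t + (-61073777 / 6435000000) * t ^ 2
  + (-437894323 / 27348750000) * t ^ 3 + (-30480107 / 178750000) * t ^ 4
  + (-1929843293 / 6837187500) * t ^ 5 + (7113078 / 11171875) * t ^ 6 + (2748952 / 1519375) * t ^ 7
  + (-192148 / 95625) * t ^ 9 + (489104 / 478125) * t ^ 11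

/-- The value at the left endpoint, a small negative constant, is split off. The remaining quotient
by -(t - a) is homogeneous in the distances s, u to the two endpoints, with positive coefficients.
-/
theorem certInner_neg_of_le_neg_eleven_div_twenty {t : ℝ}
    (hs : -70711 / 100000 ≤ t) (hu : t ≤ -11 / 20) : certInner t < 0 := by
  obtain ⟨s, hs'⟩ : ∃ s, s = t - (-70711 / 100000) := ⟨_, rfl⟩
  obtain ⟨u, hu'⟩ : ∃ u, u = -11 / 20 - t := ⟨_, rfl⟩
  have hs0 : 0 ≤ s := by linarith
  have hu0 : 0 ≤ u := by linarith
  have hw : 0 ≤ (t - (-70711 / 100000)) := by linarith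
  have hq : 0 ≤
      1802973541561606874763958332412450199123731837816814672 / 1606390655501522633833879524910423876310806753125 * u ^ 10
      + 3046365462081083144899011368162204688481657356058174672 / 321278131100304526766775904982084775262161350625 * s * u ^ 9
      + 5456922132044349194823544833430040475815590501906252304 / 154689470529776253628447657954337114015114724375 * s ^ 2 * u ^ 8
      + 106274766920869079893037986243837168926744313034312541472 / 1392205234767986282656028921589034026136032519375 * s ^ 3 * u ^ 7
      + 742114890559311347497677140619813343632150191240187790304 / 6961026173839931413280144607945170130680162596875 * s ^ 4 * u ^ 6
      + 960072505846168809455845079873456842705281469465278176 / 9548732748751620594348620861378834198463871875 * s ^ 5 * u ^ 5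
      + 5315535851519949758706664808395155784303783119665443616 / 81894425574587428391531113034649060360943089375 * s ^ 6 * u ^ 4
      + 3034711698917112223428282732508371089737088962858174672 / 107092710366768175588925301660694925087387116875 * s ^ 7 * u ^ 3
      + 72885228232275238808588631312873255264884872586397104 / 9099380619398603154614568114961006706771454375 * s ^ 8 * u ^ 2
      + 27647799533079464920048431772608824166582156517156270736 / 20883078521519794239840433823835510392040487790625 * s ^ 9 * u
      + 2029332118304602222845311979328074924234741501559660976 / 20883078521519794239840433823835510392040487790625 * s ^ 10 := by
    positivity
  have key : certInner t = -((t - (-70711 / 100000)) * (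
      1802973541561606874763958332412450199123731837816814672 / 1606390655501522633833879524910423876310806753125 * u ^ 10
      + 3046365462081083144899011368162204688481657356058174672 / 321278131100304526766775904982084775262161350625 * s * u ^ 9
      + 5456922132044349194823544833430040475815590501906252304 / 154689470529776253628447657954337114015114724375 * s ^ 2 * u ^ 8
      + 106274766920869079893037986243837168926744313034312541472 / 1392205234767986282656028921589034026136032519375 * s ^ 3 * u ^ 7
      + 742114890559311347497677140619813343632150191240187790304 / 6961026173839931413280144607945170130680162596875 * s ^ 4 * u ^ 6
      + 960072505846168809455845079873456842705281469465278176 / 9548732748751620594348620861378834198463871875 * s ^ 5 * u ^ 5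
      + 5315535851519949758706664808395155784303783119665443616 / 81894425574587428391531113034649060360943089375 * s ^ 6 * u ^ 4
      + 3034711698917112223428282732508371089737088962858174672 / 107092710366768175588925301660694925087387116875 * s ^ 7 * u ^ 3
      + 72885228232275238808588631312873255264884872586397104 / 9099380619398603154614568114961006706771454375 * s ^ 8 * u ^ 2
      + 27647799533079464920048431772608824166582156517156270736 / 20883078521519794239840433823835510392040487790625 * s ^ 9 * u
      + 2029332118304602222845311979328074924234741501559660976 / 20883078521519794239840433823835510392040487790625 * s ^ 10))
      - 1018865239456859502663186664307823451851139141439413380889 / 2172779296875000000000000000000000000000000000000000000000000000 := by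
    rw [certInner, hs', hu']
    ring
  have := mul_nonneg hw hq
  linarith

/-- Here the polynomial almost touches zero inside the interval. The tangent line at -2077/5000, a
rational point close to the local maximum, is split off; what remains is -(t + 2077/5000)² times a
form with positive coefficients. The next two lemmas and `certOuter_neg` work in the same way. -/
theorem certInner_neg_of_le_neg_three_div_ten {t : ℝ}
    (hs : -11 / 20 ≤ t) (hu : t ≤ -3 / 10) : certInner t < 0 := by
  obtain ⟨s, hs'⟩ : ∃ s, s = t - (-11 / 20) := ⟨_, rfl⟩
  obtain ⟨u, hu'⟩ : ∃ u, u = -3 / 10 - t := ⟨_, rfl⟩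
  have hs0 : 0 ≤ s := by linarith
  have hu0 : 0 ≤ u := by linarith
  have hw : 0 ≤ (t - (-2077 / 5000)) ^ 2 := by positivity
  have hq : 0 ≤
      1608733180534066403801342561334346801 / 795953383203595876693725585937500 * u ^ 9
      + 54911541819891370529623719421395879461 / 3183813532814383506774902343750000 * s * u ^ 8
      + 48408742763966489909968624544077852211 / 795953383203595876693725585937500 * s ^ 2 * u ^ 7
      + 8469421387475482401005055605741260219 / 72359398473054170608520507812500 * s ^ 3 * u ^ 6
      + 12048285111522398375371483572493029839 / 88439264800399541854858398437500 * s ^ 4 * u ^ 5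
      + 4072257193931231488966463604836453993 / 40818122215569019317626953125000 * s ^ 5 * u ^ 4
      + 4068861099313488879798141881030453101 / 88439264800399541854858398437500 * s ^ 6 * u ^ 3
      + 10242840429620571740774215935265840961 / 795953383203595876693725585937500 * s ^ 7 * u ^ 2
      + 393396785609847105112247849106840896 / 198988345800898969173431396484375 * s ^ 8 * u
      + 134917767235185844759076551461843943 / 1061271177604794502258300781250000 * s ^ 9 := by
    positivity
  -- Minus the tangent line, written in s and u; it is strictly positive since s + u = 1/4.
  have hr : 0 < 2342837113894560882590094933663829065884731 / 862003505229949951171875000000000000000000000000 * u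
      + 2806702144228416331300771249715799972529933 / 1149338006973266601562500000000000000000000000000 * s := by
    linarith
  have key : certInner t = -((t - (-2077 / 5000)) ^ 2 * (
      1608733180534066403801342561334346801 / 795953383203595876693725585937500 * u ^ 9
      + 54911541819891370529623719421395879461 / 3183813532814383506774902343750000 * s * u ^ 8
      + 48408742763966489909968624544077852211 / 795953383203595876693725585937500 * s ^ 2 * u ^ 7
      + 8469421387475482401005055605741260219 / 72359398473054170608520507812500 * s ^ 3 * u ^ 6
      + 12048285111522398375371483572493029839 / 88439264800399541854858398437500 * s ^ 4 * u ^ 5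
      + 4072257193931231488966463604836453993 / 40818122215569019317626953125000 * s ^ 5 * u ^ 4
      + 4068861099313488879798141881030453101 / 88439264800399541854858398437500 * s ^ 6 * u ^ 3
      + 10242840429620571740774215935265840961 / 795953383203595876693725585937500 * s ^ 7 * u ^ 2
      + 393396785609847105112247849106840896 / 198988345800898969173431396484375 * s ^ 8 * u
      + 134917767235185844759076551461843943 / 1061271177604794502258300781250000 * s ^ 9))
      - (2342837113894560882590094933663829065884731 / 862003505229949951171875000000000000000000000000 * u + 2806702144228416331300771249715799972529933 / 1149338006973266601562500000000000000000000000000 * s) := by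
    rw [certInner, hs', hu']
    ring
  have := mul_nonneg hw hq
  linarith

theorem certInner_neg_of_le_neg_one_div_twenty {t : ℝ}
    (hs : -3 / 10 ≤ t) (hu : t ≤ -1 / 20) : certInner t < 0 := by
  obtain ⟨s, hs'⟩ : ∃ s, s = t - (-3 / 10) := ⟨_, rfl⟩
  obtain ⟨u, hu'⟩ : ∃ u, u = -1 / 20 - t := ⟨_, rfl⟩
  have hs0 : 0 ≤ s := by linarith
  have hu0 : 0 ≤ u := by linarith
  have hw : 0 ≤ (t - (-213 / 1000)) ^ 2 := by positivity
  have hq : 0 ≤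
      1589636271841101011650003961 / 7376074790954589843750000 * u ^ 9
      + 2191279565700920673567711448427 / 815056264400482177734375000 * s * u ^ 8
      + 433913919590133633160381812233 / 31348317861557006835937500 * s ^ 2 * u ^ 7
      + 5236020405242202223003916500867 / 135842710733413696289062500 * s ^ 3 * u ^ 6
      + 52216725619207154926631282389903 / 815056264400482177734375000 * s ^ 4 * u ^ 5
      + 13453145045540966187462336346907 / 203764066100120544433593750 * s ^ 5 * u ^ 4
      + 5738558856096642469075182161567 / 135842710733413696289062500 * s ^ 6 * u ^ 3
      + 6598135005405634092128623791779 / 407528132200241088867187500 * s ^ 7 * u ^ 2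
      + 499880583137467000925582311439 / 148192048072814941406250000 * s ^ 8 * u
      + 237752718208630256463777203153 / 815056264400482177734375000 * s ^ 9 := by
    positivity
  have hr : 0 < 6128400585461265432660308551883089 / 1810649414062500000000000000000000000000 * u
      + 9254625061056014943797175723541147 / 3923073730468750000000000000000000000000 * s := by
    linarith
  have key : certInner t = -((t - (-213 / 1000)) ^ 2 * (
      1589636271841101011650003961 / 7376074790954589843750000 * u ^ 9
      + 2191279565700920673567711448427 / 815056264400482177734375000 * s * u ^ 8
      + 433913919590133633160381812233 / 31348317861557006835937500 * s ^ 2 * u ^ 7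
      + 5236020405242202223003916500867 / 135842710733413696289062500 * s ^ 3 * u ^ 6
      + 52216725619207154926631282389903 / 815056264400482177734375000 * s ^ 4 * u ^ 5
      + 13453145045540966187462336346907 / 203764066100120544433593750 * s ^ 5 * u ^ 4
      + 5738558856096642469075182161567 / 135842710733413696289062500 * s ^ 6 * u ^ 3
      + 6598135005405634092128623791779 / 407528132200241088867187500 * s ^ 7 * u ^ 2
      + 499880583137467000925582311439 / 148192048072814941406250000 * s ^ 8 * u
      + 237752718208630256463777203153 / 815056264400482177734375000 * s ^ 9))
      - (6128400585461265432660308551883089 / 1810649414062500000000000000000000000000 * u + 9254625061056014943797175723541147 / 3923073730468750000000000000000000000000 * s) := by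
    rw [certInner, hs', hu']
    ring
  have := mul_nonneg hw hq
  linarith

theorem certInner_neg_of_le_three_div_ten {t : ℝ}
    (hs : -1 / 20 ≤ t) (hu : t ≤ 3 / 10) : certInner t < 0 := by
  obtain ⟨s, hs'⟩ : ∃ s, s = t - (-1 / 20) := ⟨_, rfl⟩
  obtain ⟨u, hu'⟩ : ∃ u, u = 3 / 10 - t := ⟨_, rfl⟩
  have hs0 : 0 ≤ s := by linarith
  have hu0 : 0 ≤ u := by linarith
  have hw : 0 ≤ (t - (163 / 2000)) ^ 2 := by positivity
  have hq : 0 ≤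
      3745251131609223416412300888811 / 174182561464843750000000000000 * u ^ 9
      + 5568436900050488011863183691682191 / 17244073585019531250000000000000 * s * u ^ 8
      + 8917854793088948906024561503986781 / 4311018396254882812500000000000 * s ^ 2 * u ^ 7
      + 20619029001228835593838819538717 / 2786695795898437500000000000 * s ^ 3 * u ^ 6
      + 2222039747200667553251500119728329 / 136857726865234375000000000000 * s ^ 4 * u ^ 5
      + 9272120481708178639594257006489517 / 410573180595703125000000000000 * s ^ 5 * u ^ 4
      + 1356329178055242599752547279082783 / 68428863432617187500000000000 * s ^ 6 * u ^ 3
      + 45382592101886015825815340490179731 / 4311018396254882812500000000000 * s ^ 7 * u ^ 2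
      + 52575394224081501745229161759627321 / 17244073585019531250000000000000 * s ^ 8 * u
      + 6253497234132691602125199747655879 / 17244073585019531250000000000000 * s ^ 9 := by
    positivity
  have hr : 0 < 44676644624282867160046303380078217009 / 18406206000000000000000000000000000000000000 * u
      + 50949394182583786519141284247894271599 / 18406206000000000000000000000000000000000000 * s := by
    linarith
  have key : certInner t = -((t - (163 / 2000)) ^ 2 * (
      3745251131609223416412300888811 / 174182561464843750000000000000 * u ^ 9
      + 5568436900050488011863183691682191 / 17244073585019531250000000000000 * s * u ^ 8
      + 8917854793088948906024561503986781 / 4311018396254882812500000000000 * s ^ 2 * u ^ 7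
      + 20619029001228835593838819538717 / 2786695795898437500000000000 * s ^ 3 * u ^ 6
      + 2222039747200667553251500119728329 / 136857726865234375000000000000 * s ^ 4 * u ^ 5
      + 9272120481708178639594257006489517 / 410573180595703125000000000000 * s ^ 5 * u ^ 4
      + 1356329178055242599752547279082783 / 68428863432617187500000000000 * s ^ 6 * u ^ 3
      + 45382592101886015825815340490179731 / 4311018396254882812500000000000 * s ^ 7 * u ^ 2
      + 52575394224081501745229161759627321 / 17244073585019531250000000000000 * s ^ 8 * u
      + 6253497234132691602125199747655879 / 17244073585019531250000000000000 * s ^ 9))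
      - (44676644624282867160046303380078217009 / 18406206000000000000000000000000000000000000 * u + 50949394182583786519141284247894271599 / 18406206000000000000000000000000000000000000 * s) := by
    rw [certInner, hs', hu']
    ring
  have := mul_nonneg hw hq
  linarith

/-- The critical point is now the right endpoint, so the value at 1/2 and the factor 1/2 - t are
split off. -/
theorem certInner_neg_of_le_one_div_two {t : ℝ}
    (hs : 3 / 10 ≤ t) (hu : t ≤ 1 / 2) : certInner t < 0 := by
  obtain ⟨s, hs'⟩ : ∃ s, s = t - (3 / 10) := ⟨_, rfl⟩
  obtain ⟨u, hu'⟩ : ∃ u, u = 1 / 2 - t := ⟨_, rfl⟩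
  have hs0 : 0 ≤ s := by linarith
  have hu0 : 0 ≤ u := by linarith
  have hw : 0 ≤ (1 / 2 - t) := by linarith
  have hq : 0 ≤
      1071734720129 / 16087500 * u ^ 10 + 767825513993731 / 875160000 * s * u ^ 9
      + 60188878041317 / 11668800 * s ^ 2 * u ^ 8 + 15602897551499 / 875160 * s ^ 3 * u ^ 7
      + 1032777810457 / 25740 * s ^ 4 * u ^ 6 + 358446773060929 / 5834400 * s ^ 5 * u ^ 5
      + 45383704094603 / 700128 * s ^ 6 * u ^ 4 + 119788453151 / 2574 * s ^ 7 * u ^ 3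
      + 1269487790525 / 58344 * s ^ 8 * u ^ 2 + 71605869475 / 11968 * s ^ 9 * u
      + 343003969625 / 466752 * s ^ 10 := by
    positivity
  have key : certInner t = -((1 / 2 - t) * (
      1071734720129 / 16087500 * u ^ 10 + 767825513993731 / 875160000 * s * u ^ 9
      + 60188878041317 / 11668800 * s ^ 2 * u ^ 8 + 15602897551499 / 875160 * s ^ 3 * u ^ 7
      + 1032777810457 / 25740 * s ^ 4 * u ^ 6 + 358446773060929 / 5834400 * s ^ 5 * u ^ 5
      + 45383704094603 / 700128 * s ^ 6 * u ^ 4 + 119788453151 / 2574 * s ^ 7 * u ^ 3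
      + 1269487790525 / 58344 * s ^ 8 * u ^ 2 + 71605869475 / 11968 * s ^ 9 * u
      + 343003969625 / 466752 * s ^ 10))
      - 3123143 / 2629458000000 := by
    rw [certInner, hs', hu']
    ring
  have := mul_nonneg hw hq
  linarith

theorem certOuter_neg {t : ℝ}
    (hs : -1 ≤ t) (hu : t ≤ -7071 / 10000) : certOuter t < 0 := by
  obtain ⟨s, hs'⟩ : ∃ s, s = t - (-1) := ⟨_, rfl⟩
  obtain ⟨u, hu'⟩ : ∃ u, u = -7071 / 10000 - t := ⟨_, rfl⟩
  have hs0 : 0 ≤ s := by linarith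
  have hu0 : 0 ≤ u := by linarith
  have hw : 0 ≤ (t - (-80701 / 100000)) ^ 2 := by positivity
  have hq : 0 ≤
      237159320313908700507640961450818677854565527044489 / 2260011232907430027164547577802498378906250000 * u ^ 9
      + 362188301870018732019629914887341403509595662979043 / 565002808226857506791136894450624594726562500 * s * u ^ 8
      + 2909944459005236709150189312216781927773924008032769 / 1695008424680572520373410683351873784179687500 * s ^ 2 * u ^ 7
      + 262626155045279242137465228017410365213651345954209 / 99706377922386618845494746079521987304687500 * s ^ 3 * u ^ 6
      + 572597965046548081358326404690880346992895850140891 / 226001123290743002716454757780249837890625000 * s ^ 4 * u ^ 5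
      + 241217660585807661370610863186665144691917633265883 / 154091674970961138215764607577443071289062500 * s ^ 5 * u ^ 4
      + 1028999890517365164434183984211092203879471993792589 / 1695008424680572520373410683351873784179687500 * s ^ 6 * u ^ 3
      + 76380494045105733357579229528599009840292469824253 / 565002808226857506791136894450624594726562500 * s ^ 7 * u ^ 2
      + 89799748889294989288697235346072218020436364119427 / 6780033698722290081493642733407495136718750000 * s ^ 8 * u
      + 149094021346311667682158189123746697629363911 / 169500842468057252037341068335187378417968750 * s ^ 9 := by
    positivity
  have hr : 0 < 1007644260168859612150289366036627985100693451761637266513 / 827329172871093750000000000000000000000000000000000000000000000 * u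
      + 1706727099299324436734539597684426633845580649731355473 / 1591017640136718750000000000000000000000000000000000000000000 * s := by
    linarith
  have key : certOuter t = -((t - (-80701 / 100000)) ^ 2 * (
      237159320313908700507640961450818677854565527044489 / 2260011232907430027164547577802498378906250000 * u ^ 9
      + 362188301870018732019629914887341403509595662979043 / 565002808226857506791136894450624594726562500 * s * u ^ 8
      + 2909944459005236709150189312216781927773924008032769 / 1695008424680572520373410683351873784179687500 * s ^ 2 * u ^ 7
      + 262626155045279242137465228017410365213651345954209 / 99706377922386618845494746079521987304687500 * s ^ 3 * u ^ 6
      + 572597965046548081358326404690880346992895850140891 / 226001123290743002716454757780249837890625000 * s ^ 4 * u ^ 5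
      + 241217660585807661370610863186665144691917633265883 / 154091674970961138215764607577443071289062500 * s ^ 5 * u ^ 4
      + 1028999890517365164434183984211092203879471993792589 / 1695008424680572520373410683351873784179687500 * s ^ 6 * u ^ 3
      + 76380494045105733357579229528599009840292469824253 / 565002808226857506791136894450624594726562500 * s ^ 7 * u ^ 2
      + 89799748889294989288697235346072218020436364119427 / 6780033698722290081493642733407495136718750000 * s ^ 8 * u
      + 149094021346311667682158189123746697629363911 / 169500842468057252037341068335187378417968750 * s ^ 9))
      - (1007644260168859612150289366036627985100693451761637266513 / 827329172871093750000000000000000000000000000000000000000000000 * u + 1706727099299324436734539597684426633845580649731355473 / 1591017640136718750000000000000000000000000000000000000000000 * s) := by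
    rw [certOuter, hs', hu']
    ring
  have := mul_nonneg hw hq
  linarith

/-! ### Explicit Gegenbauer polynomials and the bounds on the certificate -/

theorem eval_gegenbauer_add_two (n k : ℕ) (t : ℝ) :
    (gegenbauer n (k + 2)).eval t = ((k : ℝ) + n - 1)⁻¹ *
      ((2 * (k : ℝ) + n) * t * (gegenbauer n (k + 1)).eval t
        - ((k : ℝ) + 1) * (gegenbauer n k).eval t) := by
  simp [gegenbauer]

theorem kissingCertificate_eq (t : ℝ) :
    kissingCertificate t + 1 / 594.9 = certInner t + 0.006165 * fAngle (Real.pi / 3) t := by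
  have h0 : (gegenbauer 10 0).eval t = 1 := by simp [gegenbauer]
  have h1 : (gegenbauer 10 1).eval t = t := by simp [gegenbauer]
  have h2 : (gegenbauer 10 2).eval t =
      (-1 / 9) + (10 / 9) * t ^ 2 := by
    rw [eval_gegenbauer_add_two, h1, h0]
    push_cast
    ring
  have h3 : (gegenbauer 10 3).eval t =
      (-1 / 3) * t + (4 / 3) * t ^ 3 := by
    rw [eval_gegenbauer_add_two, h2, h1]
    push_cast
    ring
  have h4 : (gegenbauer 10 4).eval t =
      (1 / 33) + (-8 / 11) * t ^ 2 + (56 / 33) * t ^ 4 := by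
    rw [eval_gegenbauer_add_two, h3, h2]
    push_cast
    ring
  have h5 : (gegenbauer 10 5).eval t =
      (5 / 33) * t + (-140 / 99) * t ^ 3 + (224 / 99) * t ^ 5 := by
    rw [eval_gegenbauer_add_two, h4, h3]
    push_cast
    ring
  have h6 : (gegenbauer 10 6).eval t =
      (-5 / 429) + (70 / 143) * t ^ 2 + (-1120 / 429) * t ^ 4 + (448 / 143) * t ^ 6 := by
    rw [eval_gegenbauer_add_two, h5, h4]
    push_cast
    ring
  have h7 : (gegenbauer 10 7).eval t =
      (-35 / 429) * t + (560 / 429) * t ^ 3 + (-672 / 143) * t ^ 5 + (640 / 143) * t ^ 7 := by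
    rw [eval_gegenbauer_add_two, h6, h5]
    push_cast
    ring
  -- Degrees 8 to 10 do not occur in the certificate; they only feed the recurrence for degree 11.
  have h8 : (gegenbauer 10 8).eval t =
      (7 / 1287) + (-448 / 1287) * t ^ 2 + (448 / 143) * t ^ 4 + (-3584 / 429) * t ^ 6
      + (256 / 39) * t ^ 8 := by
    rw [eval_gegenbauer_add_two, h7, h6]
    push_cast
    ring
  have h9 : (gegenbauer 10 9).eval t =
      (7 / 143) * t + (-168 / 143) * t ^ 3 + (1008 / 143) * t ^ 5 + (-192 / 13) * t ^ 7
      + (128 / 13) * t ^ 9 := by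
    rw [eval_gegenbauer_add_two, h8, h7]
    push_cast
    ring
  have h10 : (gegenbauer 10 10).eval t =
      (-7 / 2431) + (630 / 2431) * t ^ 2 + (-8400 / 2431) * t ^ 4 + (3360 / 221) * t ^ 6
      + (-5760 / 221) * t ^ 8 + (256 / 17) * t ^ 10 := by
    rw [eval_gegenbauer_add_two, h9, h8]
    push_cast
    ring
  have h11 : (gegenbauer 10 11).eval t =
      (-7 / 221) * t + (700 / 663) * t ^ 3 + (-6160 / 663) * t ^ 5 + (7040 / 221) * t ^ 7
      + (-7040 / 153) * t ^ 9 + (3584 / 153) * t ^ 11 := by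
    rw [eval_gegenbauer_add_two, h10, h9]
    push_cast
    ring
  rw [kissingCertificate, certInner, h1, h2, h3, h4, h5, h6, h7, h11]
  ring

theorem kissingCertificate_add_neg {t : ℝ} (h₁ : -1 ≤ t) (h₂ : t ≤ 1 / 2) :
    kissingCertificate t + 1 / 594.9 < 0 := by
  have hsq : √(1 / 2 : ℝ) ^ 2 = 1 / 2 := Real.sq_sqrt (by norm_num)
  have hpos := Real.sqrt_nonneg (1 / 2 : ℝ)
  rw [kissingCertificate_eq, fAngle_pi_div_three]
  split_ifs with h
  -- The breakpoint -1/√2 lies between -0.70711 and -0.7071; the rational ranges for `certInner` and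
  -- `certOuter` overlap slightly around it.
  · have := certOuter_neg h₁ (by nlinarith : t ≤ -7071 / 10000)
    have e : certInner t + 0.006165 * (1 - 2 * t ^ 2) = certOuter t := by
      rw [certInner, certOuter]
      ring
    rwa [e]
  · rw [mul_zero, add_zero]
    have h0 : -70711 / 100000 ≤ t := by nlinarith
    rcases le_total t (-11 / 20) with h3 | h3
    · exact certInner_neg_of_le_neg_eleven_div_twenty h0 h3
    rcases le_total t (-3 / 10) with h4 | h4
    · exact certInner_neg_of_le_neg_three_div_ten h3 h4
    rcases le_total t (-1 / 20) with h5 | h5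
    · exact certInner_neg_of_le_neg_one_div_twenty h4 h5
    rcases le_total t (3 / 10) with h6 | h6
    · exact certInner_neg_of_le_three_div_ten h5 h6
    · exact certInner_neg_of_le_one_div_two h6 h₂

theorem kissingCertificate_one_add_lt_one : kissingCertificate 1 + 1 / 594.9 < 1 := by
  have hsq : √(1 / 2 : ℝ) ^ 2 = 1 / 2 := Real.sq_sqrt (by norm_num)
  have hpos := Real.sqrt_nonneg (1 / 2 : ℝ)
  rw [kissingCertificate_eq, fAngle_pi_div_three, if_neg (by linarith), certInner]
  norm_num

/-! ### The linear programming bound -/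

/-- The linear programming bound for `(10, N, π/3)`-codes. -/
theorem IsSphericalCode.le_of_pi_div_three {N : ℕ} {X : Fin N → EuclideanSpace ℝ (Fin 10)}
    (hX : IsSphericalCode 10 N (Real.pi / 3) X) : N ≤ 594 := by
  have h1 : ∀ i j, kissingCertificate (inner ℝ (X i) (X j))
      ≤ -(1 / 594.9) + if j = i then 1 else 0 := by
    intro i j
    split_ifs with hij
    · rw [hij, real_inner_self_eq_norm_sq, hX.norm_eq_one, one_pow]
      linarith [kissingCertificate_one_add_lt_one]
    · have hlow : -1 ≤ inner ℝ (X i) (X j) := by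
        have := neg_le_of_abs_le (abs_real_inner_le_norm (X i) (X j))
        rwa [hX.norm_eq_one, hX.norm_eq_one, mul_one] at this
      linarith [kissingCertificate_add_neg hlow (hX.inner_le_half (Ne.symm hij))]
  have h2 := (sum_kissingCertificate_nonneg hX).trans
    (Finset.sum_le_sum fun i _ => Finset.sum_le_sum fun j _ => h1 i j)
  -- This evaluates the upper bound to N - N²/594.9, which is negative once N ≥ 595.
  simp only [Finset.sum_add_distrib, Finset.sum_const, Finset.card_univ, Fintype.card_fin,
    nsmul_eq_mul, Finset.sum_ite_eq', Finset.mem_univ, if_true, mul_one] at h2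
  by_contra! hN
  have hN' : (595 : ℝ) ≤ N := by exact_mod_cast hN
  norm_num at h2
  nlinarith

/-! ### From kissing configurations to spherical codes -/

theorem IsKissingConfiguration.norm_eq_two {n : ℕ} {C : Set (EuclideanSpace ℝ (Fin n))}
    (hC : IsKissingConfiguration n C) {c : EuclideanSpace ℝ (Fin n)} (hc : c ∈ C) : ‖c‖ = 2 := by
  refine le_antisymm ?_ ?_
  · obtain ⟨p, hp, hp'⟩ := hC.touches_central c hc
    rw [Metric.mem_closedBall, dist_eq_norm] at hp hp'
    have := norm_sub_le (p - 0) (p - c)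
    simp only [sub_zero, sub_sub_cancel] at this hp'
    linarith
  · have := (disjoint_ball_ball_iff one_pos one_pos).1 (hC.not_overlap_central c hc)
    rw [dist_zero_right] at this
    linarith

/-- Disjoint unit balls have centres at distance at least 2, and both centres have norm 2: expand ‖c
- d‖² ≥ 4. -/
theorem IsKissingConfiguration.inner_le_two {n : ℕ} {C : Set (EuclideanSpace ℝ (Fin n))}
    (hC : IsKissingConfiguration n C) {c d : EuclideanSpace ℝ (Fin n)} (hc : c ∈ C) (hd : d ∈ C)
    (hcd : c ≠ d) : inner ℝ c d ≤ 2 := by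
  have h := (disjoint_ball_ball_iff one_pos one_pos).1 (hC.not_overlap hc hd hcd)
  rw [dist_eq_norm] at h
  have h2 := norm_sub_sq_real c d
  rw [hC.norm_eq_two hc, hC.norm_eq_two hd] at h2
  nlinarith

theorem IsKissingConfiguration.isSphericalCode {n N : ℕ} {C : Set (EuclideanSpace ℝ (Fin n))}
    (hC : IsKissingConfiguration n C) (X : Fin N ↪ EuclideanSpace ℝ (Fin n))
    (hX : ∀ i, X i ∈ C) :
    IsSphericalCode n N (Real.pi / 3) fun i => (1 / 2 : ℝ) • X i := by
  refine ⟨fun i => ?_, fun i j hij => ?_⟩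
  · rw [norm_smul, hC.norm_eq_two (hX i)]
    norm_num
  · rw [InnerProductGeometry.angle_smul_left_of_pos _ _ (by norm_num),
      InnerProductGeometry.angle_smul_right_of_pos _ _ (by norm_num)]
    have h := hC.inner_le_two (hX i) (hX j) (X.injective.ne hij)
    by_contra! hlt
    have hcos := Real.cos_lt_cos_of_nonneg_of_le_pi (InnerProductGeometry.angle_nonneg _ _)
      (by linarith [Real.pi_pos]) hlt
    rw [InnerProductGeometry.cos_angle, hC.norm_eq_two (hX i), hC.norm_eq_two (hX j),
      Real.cos_pi_div_three] at hcos
    linarith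

theorem kissingNumber_ten_le : kissingNumber 10 ≤ 594 := by
  refine iSup₂_le fun C hC => ?_
  by_contra! h
  -- `C` may be infinite a priori, so a subset of exactly 595 centres is extracted and indexed by
  -- `Fin 595`.
  have h595 : ((595 : ℕ) : ℕ∞) ≤ C.encard := by
    have := Order.add_one_le_of_lt h
    norm_num at this
    exact_mod_cast this
  obtain ⟨t, htC, ht⟩ := Set.exists_subset_encard_eq h595
  have htf : t.Finite := Set.finite_of_encard_eq_coe ht
  have hcard : htf.toFinset.card = 595 := by
    rw [htf.encard_eq_coe_toFinset_card] at ht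
    exact_mod_cast ht
  let e := htf.toFinset.equivFinOfCardEq hcard
  have := (hC.isSphericalCode (e.symm.toEmbedding.trans (Function.Embedding.subtype _))
    fun i => htC (htf.mem_toFinset.1 (e.symm i).2)).le_of_pi_div_three
  norm_num at this

theorem theorem4p4 :
    kissingNumber 10 ≤ 594 ∧
    (∀ (N : ℕ) (X : Fin N → EuclideanSpace ℝ (Fin 10)), IsSphericalCode 10 N (Real.pi / 3) X →
      0 ≤ ∑ i, ∑ j, kissingCertificate (inner ℝ (X i) (X j))) ∧
    (∀ t : ℝ, -1 ≤ t → t ≤ Real.cos (Real.pi / 3) → kissingCertificate t + 1 / 594.9 < 0) ∧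
    kissingCertificate 1 + 1 / 594.9 < 1 :=
  ⟨kissingNumber_ten_le, fun _ _ hX => sum_kissingCertificate_nonneg hX,
    fun _ h₁ h₂ => kissingCertificate_add_neg h₁ (by rwa [Real.cos_pi_div_three] at h₂),
    kissingCertificate_one_add_lt_one⟩
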